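/- Let $d\ge 2$ and let $(\tau_e)_{e\in E(\mathbb{Z}^d)}$ be independent, identically distributed non-negative random variables indexed by the nearest-neighbour edges of $\mathbb{Z}^d$. For $x,y\in\mathbb{R}^d$ let $$\mathrm{T}(x,y)=\inf_{\gamma:\lfloor x\rfloor\to\lfloor y\rfloor}\ \sum_{e\in\gamma}\tau_e ,$$ where the infimum runs over all finite nearest-neighbour paths $\gamma$ in $\mathbb{Z}^d$ from $\lfloor x\rfloor$ to $\lfloor y\rfloor$ (integer parts taken coordinatewise). Let $\mathbf{e}_1$ be the first coordinate vector and let $$\mu(\mathbf{e}_1)=\lim_{t\to\infty}t^{-1}\,\mathbb{E}[\mathrm{T}(0,t\mathbf{e}_1)]$$ be the time constant. Assume that there are constants $\alpha,\beta>0$ and $r>d$ such that $\mathbb{P}(\tau_e\ge t)\le \beta e^{-\alpha t^r}$ for all $t\ge 0$, and that $\tau_e$ is unbounded, i.e. $\mathbb{P}(\tau_e>m)>0$ for every $m>0$. For $\xi>0$ define $$\overline{I}(\xi)=\limsup_{n\to\infty}\left(-\frac{1}{n^d}\log \mathbb{P}\bigl(\mathrm{T}(0,n\mathbf{e}_1)>(\mu(\mathbf{e}_1)+\xi)n\bigr)\right)\in[0,\infty].$$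 Then $$\limsup_{\xi\to 0+}\ \xi^{-d}\,\overline{I}(\xi)<\infty .$$ -/

import Mathlib

open MeasureTheory ProbabilityTheory Filter Topology

namespace FPP

/-- The nearest-neighbour graph on `ℤ^d`: `x` and `y` are adjacent when `|x - y|₁ = 1`. -/
def lattice (d : ℕ) : SimpleGraph (Fin d → ℤ) where
  Adj x y := ∑ i, |x i - y i| = 1
  symm := ⟨fun x y h => by simpa only [abs_sub_comm] using h⟩
  loopless := ⟨fun x h => by simp at h⟩

/-- The set `E(ℤ^d)` of undirected nearest-neighbour edges, as a type. -/
abbrev Edge (d : ℕ) : Type := (lattice d).edgeSet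

/-- The passage time of a path: the sum of the weights of its successive edges. -/
noncomputable def passageTime {d : ℕ} (t : Edge d → ℝ) {u v : Fin d → ℤ}
    (p : (lattice d).Walk u v) : ℝ :=
  (p.darts.map fun a => t ⟨a.edge, a.edge_mem⟩).sum

/-- The coordinatewise integer part of a point of `ℝ^d`. -/
noncomputable def floorPt {d : ℕ} (x : Fin d → ℝ) : Fin d → ℤ := fun i => ⌊x i⌋

/-- The first passage time `T(x, y)` between two points of `ℝ^d`: the infimum of the passage times
of all finite paths from `⌊x⌋` to `⌊y⌋`. -/
noncomputable def firstPassageTime {d : ℕ} (t : Edge d → ℝ) (x y : Fin d → ℝ) : ℝ :=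
  ⨅ p : (lattice d).Walk (floorPt x) (floorPt y), passageTime t p

/-- The first coordinate vector of `ℝ^d`. -/
def e₁ (d : ℕ) : Fin d → ℝ := fun i => if (i : ℕ) = 0 then 1 else 0

section Random

variable {Ω : Type*} [MeasurableSpace Ω] {d : ℕ}

/-- The time constant `μ(x) = lim_{t → ∞} t⁻¹ E[T(0, t x)]`. -/
noncomputable def timeConstant (P : Measure Ω) (τ : Edge d → Ω → ℝ) (x : Fin d → ℝ) : ℝ :=
  limUnder atTop fun t : ℝ => t⁻¹ * ∫ ω, firstPassageTime (fun e => τ e ω) 0 (t • x) ∂P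

/-- The upper-tail event `{T(0, n e₁) > (μ(e₁) + ξ) n}`. -/
def upperTailEvent (P : Measure Ω) (τ : Edge d → Ω → ℝ) (ξ : ℝ) (n : ℕ) : Set Ω :=
  {ω | (timeConstant P τ (e₁ d) + ξ) * n <
    firstPassageTime (fun e => τ e ω) 0 ((n : ℝ) • e₁ d)}

/-- `limsup_{n → ∞} - n^{-d} log P(T(0, n e₁) > (μ(e₁) + ξ) n)`, with values in the extended
reals, where `log 0 = -∞`. -/
noncomputable def upperRate (P : Measure Ω) (τ : Edge d → Ω → ℝ) (ξ : ℝ) : EReal :=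
  limsup (fun n : ℕ =>
    -(((((n : ℝ) ^ d)⁻¹ : ℝ) : EReal) * ENNReal.log (P (upperTailEvent P τ ξ n)))) atTop

end Random

end FPP

/-!
The passage time from `0` to `n e₁` is forced to exceed `(μ(e₁) + ξ) n` by making all the weights in
the `ℓ¹` ball of radius `L ≈ ξ n` around the origin larger than a fixed constant `M`. This concerns
at most `(15 ξ n)^d` edges, so it costs a probability of at least `exp (-C ξ^d n^d)`, where `C`
depends only on `P (τ_e > M)`, which is positive because the weights are unbounded. It delays the
passage time by at least `ξ n`: leaving the ball takes at least `M L`, and a point `z` of its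
boundary is at passage time at least `T(0, n e₁) - T(0, z)` from `n e₁`. This deterministic
comparison is `FPP.le_vertexTime_plant`. It is stated for the configuration `FPP.plant` in which the
weights in the ball have been *replaced* by `M`: that configuration is independent of the weights in
the ball and gives smaller passage times when these all exceed `M`
(`FPP.ExpWeights.pow_mul_le_measureReal`).

The unmodified environment has to be typical with a probability bounded below uniformly in `n`, in
two respects. Chernoff's bound along geodesics gives `T(0, z) ≤ K L` for all `z` on the boundary
(`FPP.ExpWeights.exists_speed`). Also `T(0, n e₁) ≥ (μ(e₁) - ξ) n`, since subadditivity yields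
`E T(0, n e₁) ≥ μ(e₁) n` while the second moment of `T(0, n e₁)` is of order `n²`
(`FPP.ExpWeights.exists_le_measureReal_time`); a probability bounded below is enough here, as it
disappears at the exponential scale `n^d`. With `M = K + 3` the delay suffices.
-/

namespace FPP

variable {d : ℕ}

/-! ### Passage times between lattice points -/

/-- The first passage time between two vertices of `ℤ^d`. -/
noncomputable def vertexTime (t : Edge d → ℝ) (u v : Fin d → ℤ) : ℝ :=
  ⨅ p : (lattice d).Walk u v, passageTime t p

theorem passageTime_nonneg {t : Edge d → ℝ} (ht : ∀ e, 0 ≤ t e) {u v : Fin d → ℤ}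
    (p : (lattice d).Walk u v) : 0 ≤ passageTime t p := by
  refine List.sum_nonneg fun x hx => ?_
  obtain ⟨a, -, rfl⟩ := List.mem_map.1 hx
  exact ht _

@[simp] theorem passageTime_nil (t : Edge d → ℝ) (u : Fin d → ℤ) :
    passageTime t (SimpleGraph.Walk.nil : (lattice d).Walk u u) = 0 := by
  simp [passageTime]

@[simp] theorem passageTime_cons (t : Edge d → ℝ) {u v w : Fin d → ℤ} (h : (lattice d).Adj u v)
    (p : (lattice d).Walk v w) :
    passageTime t (SimpleGraph.Walk.cons h p) =
      t ⟨s(u, v), (lattice d).mem_edgeSet.2 h⟩ + passageTime t p := by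
  simp [passageTime, SimpleGraph.Dart.edge]

theorem passageTime_append (t : Edge d → ℝ) {u v w : Fin d → ℤ} (p : (lattice d).Walk u v)
    (q : (lattice d).Walk v w) :
    passageTime t (p.append q) = passageTime t p + passageTime t q := by
  simp [passageTime]

theorem passageTime_mono {s t : Edge d → ℝ} (hst : ∀ e, s e ≤ t e) {u v : Fin d → ℤ}
    (p : (lattice d).Walk u v) : passageTime s p ≤ passageTime t p :=
  List.sum_le_sum fun _ _ => hst _

theorem vertexTime_le {t : Edge d → ℝ} (ht : ∀ e, 0 ≤ t e) {u v : Fin d → ℤ}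
    (p : (lattice d).Walk u v) : vertexTime t u v ≤ passageTime t p :=
  ciInf_le ⟨0, by rintro _ ⟨q, rfl⟩; exact passageTime_nonneg ht q⟩ p

theorem vertexTime_nonneg {t : Edge d → ℝ} (ht : ∀ e, 0 ≤ t e) (u v : Fin d → ℤ) :
    0 ≤ vertexTime t u v :=
  Real.iInf_nonneg fun p => passageTime_nonneg ht p

/-- The `ℓ¹` norm on `ℤ^d`. -/
def l1 (x : Fin d → ℤ) : ℤ := ∑ i, |x i|

theorem l1_nonneg (x : Fin d → ℤ) : 0 ≤ l1 x := Finset.sum_nonneg fun _ _ => abs_nonneg _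

theorem abs_le_l1 (x : Fin d → ℤ) (i : Fin d) : |x i| ≤ l1 x :=
  Finset.single_le_sum (f := fun i => |x i|) (fun _ _ => abs_nonneg _) (Finset.mem_univ i)

theorem l1_le_of_adj {x y : Fin d → ℤ} (h : (lattice d).Adj x y) : l1 x ≤ l1 y + 1 := by
  have h' : ∑ i, |x i - y i| = 1 := h
  rw [l1, l1, ← h', ← Finset.sum_add_distrib]
  refine Finset.sum_le_sum fun i _ => ?_
  have := abs_add_le (y i) (x i - y i)
  simpa using this

/-- A vertex at distance `k + 1` from the origin has a neighbour at distance `k`. -/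
theorem exists_adj_l1 {x : Fin d → ℤ} {k : ℕ} (hx : l1 x = k + 1) :
    ∃ y, (lattice d).Adj y x ∧ l1 y = k := by
  have hne : ∃ i, x i ≠ 0 := by
    by_contra! h
    simp [l1, h] at hx
    omega
  obtain ⟨i, hi⟩ := hne
  refine ⟨Function.update x i (x i - (x i).sign), ?_, ?_⟩
  · change ∑ j, |Function.update x i (x i - (x i).sign) j - x j| = 1
    rw [Finset.sum_eq_single i]
    · rcases lt_trichotomy (x i) 0 with h | h | h
      · simp [Int.sign_eq_neg_one_of_neg h]
      · exact absurd h hi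
      · simp [Int.sign_eq_one_of_pos h]
    · intro j _ hj
      simp [Function.update_of_ne hj]
    · simp
  · unfold l1 at hx ⊢
    rw [← Finset.add_sum_erase _ _ (Finset.mem_univ i)] at hx ⊢
    have : ∑ j ∈ Finset.univ.erase i, |Function.update x i (x i - (x i).sign) j| =
        ∑ j ∈ Finset.univ.erase i, |x j| :=
      Finset.sum_congr rfl fun j hj => by rw [Function.update_of_ne (Finset.ne_of_mem_erase hj)]
    rw [this, Function.update_self]
    rcases lt_trichotomy (x i) 0 with h | h | h
    · rw [Int.sign_eq_neg_one_of_neg h, abs_of_nonpos (by omega)]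
      rw [abs_of_neg h] at hx
      omega
    · exact absurd h hi
    · rw [Int.sign_eq_one_of_pos h, abs_of_nonneg (by omega)]
      rw [abs_of_pos h] at hx
      omega

/-- The origin is joined to `x` by a path made of `|x|₁` distinct edges. -/
theorem exists_geodesic (k : ℕ) (x : Fin d → ℤ) (hx : l1 x = k) :
    ∃ S : Finset (Edge d), S.card = k ∧ (∀ e ∈ S, ∀ v ∈ e.1, l1 v ≤ k) ∧
      ∃ p : (lattice d).Walk 0 x, ∀ t : Edge d → ℝ, passageTime t p = ∑ e ∈ S, t e := by
  induction k generalizing x with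
  | zero =>
    have : x = 0 := by
      funext i
      have := abs_le_l1 x i
      rw [hx] at this
      simpa using this
    subst this
    exact ⟨∅, by simp, by simp, SimpleGraph.Walk.nil, by simp⟩
  | succ k ih =>
    obtain ⟨y, hadj, hy⟩ := exists_adj_l1 (by simpa using hx)
    obtain ⟨S, hcard, hS, p, hp⟩ := ih y hy
    have hnot : (⟨s(y, x), (lattice d).mem_edgeSet.2 hadj⟩ : Edge d) ∉ S := by
      intro hmem
      have := hS _ hmem x (by simp)
      push_cast at hx
      omega
    refine ⟨S.cons _ hnot, by rw [Finset.card_cons, hcard], ?_, p.append (.cons hadj .nil),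
      fun t => ?_⟩
    · intro e he v hv
      rcases Finset.mem_cons.1 he with rfl | he
      · rcases Sym2.mem_iff.1 hv with rfl | rfl
        · push_cast; omega
        · exact hx.le
      · have := hS e he v hv
        push_cast; omega
    · rw [passageTime_append, hp, Finset.sum_cons]
      simp [add_comm]

theorem exists_finset_vertexTime_le {k : ℕ} {x : Fin d → ℤ} (hx : l1 x = k) :
    ∃ S : Finset (Edge d), S.card = k ∧
      ∀ t : Edge d → ℝ, (∀ e, 0 ≤ t e) → vertexTime t 0 x ≤ ∑ e ∈ S, t e := by
  obtain ⟨S, hcard, -, p, hp⟩ := exists_geodesic k x hx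
  exact ⟨S, hcard, fun t ht => (vertexTime_le ht p).trans (hp t).le⟩

/-- Translation of `ℤ^d` by `a`, as an automorphism of the lattice. -/
def shift (a : Fin d → ℤ) : lattice d ≃g lattice d where
  toEquiv := Equiv.addRight a
  map_rel_iff' := by
    intro x y
    change ∑ i, |(x + a) i - (y + a) i| = 1 ↔ ∑ i, |x i - y i| = 1
    simp

theorem passageTime_shift (t : Edge d → ℝ) (a : Fin d → ℤ) {u v : Fin d → ℤ}
    (p : (lattice d).Walk u v) :
    passageTime t (p.map (shift a).toHom) =
      passageTime (fun e => t ((shift a).mapEdgeSet e)) p := by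
  induction p with
  | nil => simp
  | cons h p ih =>
    rw [SimpleGraph.Walk.map_cons, passageTime_cons, passageTime_cons, ih]
    rfl

theorem connected : (lattice d).Preconnected := by
  have key (x : Fin d → ℤ) : (lattice d).Reachable 0 x := by
    obtain ⟨k, hk⟩ := Int.eq_ofNat_of_zero_le (l1_nonneg x)
    obtain ⟨-, -, -, p, -⟩ := exists_geodesic k x hk
    exact p.reachable
  exact fun u v => (key u).symm.trans (key v)

instance (u v : Fin d → ℤ) : Nonempty ((lattice d).Walk u v) := connected u v

instance (u v : Fin d → ℤ) : Countable ((lattice d).Walk u v) :=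
  SimpleGraph.Walk.edges_injective.countable

theorem le_vertexTime {t : Edge d → ℝ} {u v : Fin d → ℤ} {c : ℝ}
    (h : ∀ p : (lattice d).Walk u v, c ≤ passageTime t p) : c ≤ vertexTime t u v :=
  le_ciInf h

theorem vertexTime_self {t : Edge d → ℝ} (ht : ∀ e, 0 ≤ t e) (u : Fin d → ℤ) :
    vertexTime t u u = 0 :=
  le_antisymm ((vertexTime_le ht .nil).trans (passageTime_nil t u).le) (vertexTime_nonneg ht u u)

theorem vertexTime_mono {s t : Edge d → ℝ} (hs : ∀ e, 0 ≤ s e) (hst : ∀ e, s e ≤ t e)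
    (u v : Fin d → ℤ) : vertexTime s u v ≤ vertexTime t u v :=
  le_vertexTime fun p => (vertexTime_le hs p).trans (passageTime_mono hst p)

theorem vertexTime_triangle {t : Edge d → ℝ} (ht : ∀ e, 0 ≤ t e) (u v w : Fin d → ℤ) :
    vertexTime t u w ≤ vertexTime t u v + vertexTime t v w := by
  rw [← sub_le_iff_le_add]
  refine le_vertexTime fun p => ?_
  rw [sub_le_comm]
  refine le_vertexTime fun q => ?_
  rw [sub_le_iff_le_add', ← passageTime_append]
  exact vertexTime_le ht _

theorem vertexTime_add_le {t : Edge d → ℝ} (ht : ∀ e, 0 ≤ t e) (u v a : Fin d → ℤ) :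
    vertexTime t (u + a) (v + a) ≤ vertexTime (fun e => t ((shift a).mapEdgeSet e)) u v :=
  le_vertexTime fun p =>
    (vertexTime_le ht (p.map (shift a).toHom)).trans (passageTime_shift t a p).le

theorem vertexTime_le_step {t : Edge d → ℝ} (ht : ∀ e, 0 ≤ t e) {u v : Fin d → ℤ}
    (h : (lattice d).Adj u v) (w : Fin d → ℤ) :
    vertexTime t u w ≤ t ⟨s(u, v), (lattice d).mem_edgeSet.2 h⟩ + vertexTime t v w := by
  rw [← sub_le_iff_le_add']
  refine le_vertexTime fun p => ?_
  rw [sub_le_iff_le_add', ← passageTime_cons t h]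
  exact vertexTime_le ht _

/-! ### Slowing down a ball -/

/-- The cube `{x : |x i| ≤ L for all i}`. -/
noncomputable def cube (d L : ℕ) : Finset (Fin d → ℤ) :=
  Fintype.piFinset fun _ => Finset.Icc (-(L : ℤ)) L

theorem card_cube (d L : ℕ) : (cube d L).card = (2 * L + 1) ^ d := by
  have : ((L : ℤ) + 1 + (L : ℤ)).toNat = 2 * L + 1 := by omega
  simp [cube, this]

theorem mem_cube {L : ℕ} {x : Fin d → ℤ} : x ∈ cube d L ↔ ∀ i, |x i| ≤ L := by
  simp [cube, abs_le]

open Classical in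
/-- The edges with both endpoints in the `ℓ¹` ball of radius `L`, carved out of the pairs
`s(x, x + y)` with `x` in the cube of radius `L` and `y` in that of radius `1`, which makes the set
finite with a cardinality of order `L ^ d`. -/
noncomputable def ballEdges (d L : ℕ) : Finset (Edge d) :=
  (((cube d L ×ˢ cube d 1).image fun q => s(q.1, q.1 + q.2)).subtype
    (· ∈ (lattice d).edgeSet)).filter fun e => ∀ v ∈ e.1, l1 v ≤ L

theorem card_ballEdges_le (d L : ℕ) : (ballEdges d L).card ≤ (2 * L + 1) ^ d * 3 ^ d := by
  classical
  refine (Finset.card_filter_le _ _).trans ?_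
  rw [Finset.card_subtype]
  refine (Finset.card_filter_le _ _).trans (Finset.card_image_le.trans ?_)
  rw [Finset.card_product, card_cube, card_cube]

theorem mem_ballEdges {L : ℕ} {u v : Fin d → ℤ} (h : (lattice d).Adj u v) :
    (⟨s(u, v), (lattice d).mem_edgeSet.2 h⟩ : Edge d) ∈ ballEdges d L ↔ l1 u ≤ L ∧ l1 v ≤ L := by
  classical
  simp only [ballEdges, Finset.mem_filter, Finset.mem_subtype, Sym2.ball]
  refine and_iff_right_of_imp fun hL => ?_
  refine Finset.mem_image.2 ⟨(u, v - u), Finset.mem_product.2 ⟨mem_cube.2 fun i => ?_,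
    mem_cube.2 fun i => ?_⟩, by simp⟩
  · exact (abs_le_l1 u i).trans hL.1
  · have h' : ∑ i, |v i - u i| = 1 := h.symm
    have := Finset.single_le_sum (f := fun i => |v i - u i|) (fun _ _ => abs_nonneg _)
      (Finset.mem_univ i)
    rw [h'] at this
    simpa using this

open Classical in
/-- The configuration `t` with the weights in the ball of radius `L` replaced by `M`. -/
noncomputable def plant (L : ℕ) (M : ℝ) (t : Edge d → ℝ) : Edge d → ℝ :=
  fun e => if e ∈ ballEdges d L then M else t e

/-- If every vertex of the sphere of radius `L` is at passage time at least `g` from `w`, then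
raising the weights in the ball to `M` puts the origin at passage time at least `M L + g` from `w`.
The induction on the path follows the potential `M (L - |v|₁) + g` inside the ball and
`min (T(v, w)) g` outside of it. -/
theorem le_vertexTime_plant {t : Edge d → ℝ} (ht : ∀ e, 0 ≤ t e) {L : ℕ} {M g : ℝ} (hM : 0 ≤ M)
    {w : Fin d → ℤ} (hw : (L : ℤ) ≤ l1 w) (hg : ∀ z, l1 z = L → g ≤ vertexTime t z w) :
    M * L + g ≤ vertexTime (plant L M t) 0 w := by
  have key : ∀ (v w' : Fin d → ℤ) (p : (lattice d).Walk v w'), w' = w →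
      (l1 v ≤ L → M * (L - l1 v) + g ≤ passageTime (plant L M t) p) ∧
      ((L : ℤ) ≤ l1 v → min (vertexTime t v w) g ≤ passageTime (plant L M t) p) := by
    intro v w' p hw'
    induction p with
    | @nil v =>
      subst hw'
      have h0 := vertexTime_self ht v
      constructor
      · intro hL
        have hv : l1 v = L := le_antisymm hL hw
        have := hg v hv
        rw [hv]
        simp
        linarith
      · intro _
        rw [h0, passageTime_nil]
        exact min_le_left _ _
    | @cons v u w' h p ih =>
      obtain ⟨ih1, ih2⟩ := ih hw'
      have hstep := l1_le_of_adj h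
      have hstep' := l1_le_of_adj h.symm
      have hsphere : l1 v = L → min (vertexTime t v w) g = g := fun hv => min_eq_right (hg v hv)
      rw [passageTime_cons]
      by_cases hin : l1 v ≤ L ∧ l1 u ≤ L
      · have hval : plant L M t ⟨s(v, u), (lattice d).mem_edgeSet.2 h⟩ = M :=
          if_pos ((mem_ballEdges h).2 hin)
        have h1 := ih1 hin.2
        have hstepR : (l1 u : ℝ) ≤ l1 v + 1 := by exact_mod_cast hstep'
        have h2 : M * (L - l1 v) + g ≤ M + passageTime (plant L M t) p := by nlinarith
        rw [hval]
        refine ⟨fun _ => h2, fun hv => ?_⟩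
        have hv' : l1 v = L := le_antisymm hin.1 hv
        rw [hsphere hv']
        rw [hv'] at h2
        simpa using h2
      · have hval : plant L M t ⟨s(v, u), (lattice d).mem_edgeSet.2 h⟩ =
            t ⟨s(v, u), (lattice d).mem_edgeSet.2 h⟩ :=
          if_neg fun hmem => hin ((mem_ballEdges h).1 hmem)
        have h2 := ih2 (by by_contra hlt; exact hin ⟨by omega, by omega⟩)
        have h3 := vertexTime_le_step ht h w
        have h4 := ht ⟨s(v, u), (lattice d).mem_edgeSet.2 h⟩
        rw [hval]
        have h5 : min (vertexTime t v w) g ≤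
            t ⟨s(v, u), (lattice d).mem_edgeSet.2 h⟩ + passageTime (plant L M t) p := by
          rcases min_le_iff.1 h2 with h | h
          · exact (min_le_left _ _).trans (by linarith)
          · exact (min_le_right _ _).trans (by linarith)
        refine ⟨fun hv => ?_, fun _ => h5⟩
        have hv' : l1 v = L := by
          by_contra hlt
          exact hin ⟨hv, by omega⟩
        rw [hsphere hv'] at h5
        rw [hv']
        simpa using h5
  refine le_vertexTime fun p => ?_
  have := (key 0 w p rfl).1 (by simp [l1])
  simpa [l1] using this

/-! ### Moments of the passage times -/

section Moments

variable {Ω : Type*} [MeasurableSpace Ω]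

theorem measurable_passageTime {t : Edge d → Ω → ℝ} (ht : ∀ e, Measurable (t e))
    {u v : Fin d → ℤ} (p : (lattice d).Walk u v) :
    Measurable fun ω => passageTime (fun e => t e ω) p := by
  induction p with
  | nil => simp
  | cons h p ih =>
    simp only [passageTime_cons]
    exact (ht _).add ih

theorem measurable_vertexTime {t : Edge d → Ω → ℝ} (ht : ∀ e, Measurable (t e))
    (u v : Fin d → ℤ) : Measurable fun ω => vertexTime (fun e => t e ω) u v :=
  Measurable.iInf fun p => measurable_passageTime ht p

theorem integrable_exp_of_tail {P : Measure Ω} [IsProbabilityMeasure P] {X : Ω → ℝ}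
    (hX : Measurable X) (h0 : ∀ ω, 0 ≤ X ω) {α β : ℝ} (hα : 0 < α) (hβ : 0 < β)
    (htail : ∀ k : ℕ, P.real {ω | (k : ℝ) ≤ X ω} ≤ β * Real.exp (-α * k)) :
    Integrable (fun ω => Real.exp (α / 2 * X ω)) P := by
  refine ⟨by fun_prop, ?_⟩
  rw [hasFiniteIntegral_iff_ofReal (Eventually.of_forall fun ω => (Real.exp_pos _).le)]
  have hset (k : ℕ) : MeasurableSet {ω | (k : ℝ) ≤ X ω} := measurableSet_le measurable_const hX
  have hpt (ω : Ω) : ENNReal.ofReal (Real.exp (α / 2 * X ω)) ≤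
      ∑' k : ℕ, {ω | (k : ℝ) ≤ X ω}.indicator
        (fun _ => ENNReal.ofReal (Real.exp (α / 2 * (k + 1)))) ω := by
    refine le_trans ?_ (ENNReal.le_tsum ⌊X ω⌋₊)
    rw [Set.indicator_of_mem (show ω ∈ {ω' | (⌊X ω⌋₊ : ℝ) ≤ X ω'} from Nat.floor_le (h0 ω))]
    gcongr
    exact (Nat.lt_floor_add_one _).le
  refine (lintegral_mono hpt).trans_lt ?_
  rw [lintegral_tsum fun k => (measurable_const.indicator (hset k)).aemeasurable]
  have hterm (k : ℕ) : ∫⁻ ω, {ω | (k : ℝ) ≤ X ω}.indicator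
      (fun _ => ENNReal.ofReal (Real.exp (α / 2 * (k + 1)))) ω ∂P ≤
      ENNReal.ofReal (β * Real.exp (α / 2) * Real.exp (k * (-(α / 2)))) := by
    rw [lintegral_indicator_const (hset k), ← ofReal_measureReal,
      ← ENNReal.ofReal_mul (Real.exp_pos _).le]
    refine ENNReal.ofReal_le_ofReal ((mul_le_mul_of_nonneg_left (htail k)
      (Real.exp_pos _).le).trans_eq ?_)
    rw [mul_left_comm, ← Real.exp_add, mul_assoc, ← Real.exp_add]
    ring_nf
  refine (ENNReal.tsum_le_tsum hterm).trans_lt ?_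
  have hsum : Summable fun k : ℕ => β * Real.exp (α / 2) * Real.exp (k * (-(α / 2))) :=
    (Real.summable_exp_nat_mul_iff.2 (by linarith)).mul_left _
  rw [← ENNReal.ofReal_tsum_of_nonneg (fun k => by positivity) hsum]
  exact ENNReal.ofReal_lt_top

theorem integrable_sq_of_exp {P : Measure Ω} {X : Ω → ℝ} (hX : Measurable X)
    (h0 : ∀ ω, 0 ≤ X ω) {l : ℝ} (hl : 0 < l) (hexp : Integrable (fun ω => Real.exp (l * X ω)) P) :
    Integrable (fun ω => X ω ^ 2) P := by
  refine (hexp.const_mul (2 / l ^ 2)).mono' (by fun_prop) (Eventually.of_forall fun ω => ?_)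
  have h1 := Real.quadratic_le_exp_of_nonneg (mul_nonneg hl.le (h0 ω))
  have h2 := mul_nonneg hl.le (h0 ω)
  rw [Real.norm_of_nonneg (by positivity), div_mul_eq_mul_div, le_div_iff₀ (by positivity)]
  nlinarith

/-- A quantitative lower bound on the probability that `X` is almost as large as its mean, in terms
of its second moment. -/
theorem le_measureReal_of_sq_le {P : Measure Ω} [IsProbabilityMeasure P] {X : Ω → ℝ}
    (hX : Measurable X) (h0 : ∀ ω, 0 ≤ X ω) (hsq : Integrable (fun ω => X ω ^ 2) P)
    (hint : Integrable X P) {m b s n : ℝ} (hn : 0 < n) (hm : 0 < m) (hs : 0 < s)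
    (hsq_le : ∫ ω, X ω ^ 2 ∂P ≤ m * n ^ 2) (hmean : b + s * n ≤ ∫ ω, X ω ∂P) :
    min 1 (s ^ 2 / m) ≤ P.real {ω | b ≤ X ω} := by
  have hset : MeasurableSet {ω | b ≤ X ω} := measurableSet_le measurable_const hX
  rcases lt_or_ge b 0 with hb | hb
  · have : {ω | b ≤ X ω} = Set.univ := Set.eq_univ_of_forall fun ω => hb.le.trans (h0 ω)
    simp [this]
  refine (min_le_right _ _).trans ?_
  -- Young's inequality `X ≤ c X² + 1 / (4 c)` on `{b ≤ X}`, with `c` balancing the two terms.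
  set c : ℝ := s / (2 * m * n) with hc
  have hcpos : 0 < c := by positivity
  have hpt (ω : Ω) : X ω - b ≤
      c * X ω ^ 2 + {ω | b ≤ X ω}.indicator (fun _ => 1 / (4 * c)) ω := by
    by_cases h : b ≤ X ω
    · rw [Set.indicator_of_mem (show ω ∈ {ω | b ≤ X ω} from h)]
      have h1 : 0 ≤ c * (X ω - 1 / (2 * c)) ^ 2 := by positivity
      have h2 : c * (X ω - 1 / (2 * c)) ^ 2 = c * X ω ^ 2 - X ω + 1 / (4 * c) := by
        field_simp
        ring
      linarith
    · rw [Set.indicator_of_notMem (show ω ∉ {ω | b ≤ X ω} from h)]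
      have : 0 ≤ c * X ω ^ 2 := by positivity
      linarith
  have hle := integral_mono (hint.sub (integrable_const b))
    ((hsq.const_mul c).add ((integrable_const (1 / (4 * c))).indicator hset)) hpt
  simp only [Pi.add_apply, Pi.sub_apply] at hle
  rw [integral_sub hint (integrable_const b),
    integral_add (hsq.const_mul c) ((integrable_const (1 / (4 * c))).indicator hset),
    integral_const_mul, integral_indicator_const _ hset] at hle
  simp only [integral_const, probReal_univ, smul_eq_mul, one_mul] at hle
  have h1 : c * ∫ ω, X ω ^ 2 ∂P ≤ s * n / 2 := by
    refine (mul_le_mul_of_nonneg_left hsq_le hcpos.le).trans_eq ?_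
    rw [hc]
    field_simp
  have h2 : s * n / 2 ≤ P.real {ω | b ≤ X ω} * (1 / (4 * c)) := by linarith
  have h3 : 1 / (4 * c) = m * n / (2 * s) := by
    rw [hc]
    field_simp
    ring
  rw [h3] at h2
  rw [div_le_iff₀ hm]
  have h4 : s * n / 2 * (2 * s) ≤ P.real {ω | b ≤ X ω} * (m * n) := by
    rw [← le_div_iff₀ (by positivity), mul_div_assoc (P.real _)]
    exact h2
  nlinarith

end Moments

/-- Independent, identically distributed, non-negative weights with an exponential moment of
order `l`. -/
structure ExpWeights {Ω : Type*} [MeasurableSpace Ω] (P : Measure Ω) (τ : Edge d → Ω → ℝ)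
    (l : ℝ) : Prop where
  meas : ∀ e, Measurable (τ e)
  nonneg : ∀ e ω, 0 ≤ τ e ω
  indep : iIndepFun τ P
  ident : ∀ e e', IdentDistrib (τ e) (τ e') P P
  pos : 0 < l
  exp : ∀ e, Integrable (fun ω => Real.exp (l * τ e ω)) P

namespace ExpWeights

variable {Ω : Type*} [MeasurableSpace Ω] {P : Measure Ω} {τ : Edge d → Ω → ℝ} {l : ℝ}

theorem integrable_sq (h : ExpWeights P τ l) (e : Edge d) : Integrable (fun ω => τ e ω ^ 2) P :=
  integrable_sq_of_exp (h.meas e) (h.nonneg e) h.pos (h.exp e)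

theorem integral_sq_eq (h : ExpWeights P τ l) (e e' : Edge d) :
    ∫ ω, τ e ω ^ 2 ∂P = ∫ ω, τ e' ω ^ 2 ∂P :=
  ((h.ident e e').comp (measurable_id.pow_const 2)).integral_eq

theorem measurable_time (h : ExpWeights P τ l) (u v : Fin d → ℤ) :
    Measurable fun ω => vertexTime (fun e => τ e ω) u v :=
  measurable_vertexTime h.meas u v

theorem sq_time_le (h : ExpWeights P τ l) (e₀ : Edge d) {k : ℕ} {x : Fin d → ℤ} (hx : l1 x = k) :
    Integrable (fun ω => vertexTime (fun e => τ e ω) 0 x ^ 2) P ∧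
      ∫ ω, vertexTime (fun e => τ e ω) 0 x ^ 2 ∂P ≤ (∫ ω, τ e₀ ω ^ 2 ∂P) * (k : ℝ) ^ 2 := by
  obtain ⟨S, hcard, hS⟩ := exists_finset_vertexTime_le hx
  have hle (ω : Ω) : vertexTime (fun e => τ e ω) 0 x ^ 2 ≤ k * ∑ e ∈ S, τ e ω ^ 2 := by
    rw [← hcard]
    refine le_trans ?_ sq_sum_le_card_mul_sum_sq
    exact pow_le_pow_left₀ (vertexTime_nonneg (fun e => h.nonneg e ω) _ _)
      (hS _ fun e => h.nonneg e ω) 2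
  have hint : Integrable (fun ω => (k : ℝ) * ∑ e ∈ S, τ e ω ^ 2) P :=
    (integrable_finsetSum S fun e _ => h.integrable_sq e).const_mul _
  have hsq : Integrable (fun ω => vertexTime (fun e => τ e ω) 0 x ^ 2) P :=
    hint.mono' ((h.measurable_time 0 x).pow_const 2).aestronglyMeasurable
      (Eventually.of_forall fun ω => by
        rw [Real.norm_of_nonneg (sq_nonneg _)]; exact hle ω)
  refine ⟨hsq, (integral_mono hsq hint hle).trans_eq ?_⟩
  rw [integral_const_mul, integral_finsetSum S fun e _ => h.integrable_sq e,
    Finset.sum_congr rfl fun e _ => h.integral_sq_eq e e₀, Finset.sum_const, hcard, nsmul_eq_mul]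
  ring

variable [IsProbabilityMeasure P]

theorem integrable_of_sq {X : Ω → ℝ} (hX : Measurable X)
    (hsq : Integrable (fun ω => X ω ^ 2) P) : Integrable X P :=
  ((memLp_two_iff_integrable_sq hX.aestronglyMeasurable).2 hsq).integrable one_le_two

theorem integrable_time (h : ExpWeights P τ l) [Nonempty (Edge d)] (x : Fin d → ℤ) :
    Integrable (fun ω => vertexTime (fun e => τ e ω) 0 x) P := by
  obtain ⟨k, hk⟩ := Int.eq_ofNat_of_zero_le (l1_nonneg x)
  exact integrable_of_sq (h.measurable_time 0 x) (h.sq_time_le (Classical.arbitrary _) hk).1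

/-- Chernoff's bound along a geodesic. -/
theorem measureReal_le_time_le (h : ExpWeights P τ l) (e₀ : Edge d) (K : ℝ) {k : ℕ}
    {x : Fin d → ℤ} (hx : l1 x = k) :
    P.real {ω | K * k ≤ vertexTime (fun e => τ e ω) 0 x} ≤
      (Real.exp (-l * K) * mgf (τ e₀) P l) ^ k := by
  obtain ⟨S, hcard, hS⟩ := exists_finset_vertexTime_le hx
  have hsub : {ω | K * k ≤ vertexTime (fun e => τ e ω) 0 x} ⊆
      {ω | K * k ≤ (∑ e ∈ S, τ e) ω} := fun ω hω => by
    simp only [Set.mem_ofPred_eq, Finset.sum_apply] at hω ⊢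
    exact hω.trans (hS _ fun e => h.nonneg e ω)
  refine (measureReal_mono hsub).trans ((measure_ge_le_exp_mul_mgf _ h.pos.le
    (h.indep.integrable_exp_mul_sum h.meas fun e _ => h.exp e)).trans_eq ?_)
  rw [h.indep.mgf_sum h.meas, Finset.prod_congr rfl fun e _ =>
    mgf_congr_of_identDistrib _ _ (h.ident e e₀) l, Finset.prod_const, hcard, mul_pow,
    ← Real.exp_nat_mul]
  ring_nf

/-- With high probability, all points of a sphere are reached from the origin in a time linear in
the radius. -/
theorem exists_speed (h : ExpWeights P τ l) [Nonempty (Edge d)] :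
    ∃ K : ℝ, 0 ≤ K ∧ ∀ L : ℕ,
      P.real {ω | ∃ z, l1 z = L ∧ K * L ≤ vertexTime (fun e => τ e ω) 0 z} ≤
        (2 * L + 1) ^ d * (1 / 2) ^ L := by
  let e₀ : Edge d := Classical.arbitrary _
  set m := mgf (τ e₀) P l
  have hm1 : 1 ≤ m := by
    have : ∫ _, (1 : ℝ) ∂P ≤ m := integral_mono (integrable_const 1) (h.exp e₀) fun ω =>
      Real.one_le_exp (mul_nonneg h.pos.le (h.nonneg e₀ ω))
    simpa using this
  refine ⟨Real.log (2 * m) / l, div_nonneg (Real.log_nonneg (by linarith)) h.pos.le,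
    fun L => ?_⟩
  have hK : Real.exp (-l * (Real.log (2 * m) / l)) * m = 1 / 2 := by
    have : -l * (Real.log (2 * m) / l) = -Real.log (2 * m) := by
      have := h.pos.ne'
      field_simp
    rw [this, Real.exp_neg, Real.exp_log (by linarith)]
    field_simp
  set K := Real.log (2 * m) / l
  have hsub : {ω | ∃ z, l1 z = L ∧ K * L ≤ vertexTime (fun e => τ e ω) 0 z} ⊆
      ⋃ z ∈ (cube d L).filter fun z => l1 z = L,
        {ω | K * L ≤ vertexTime (fun e => τ e ω) 0 z} := by
    rintro ω ⟨z, hz, hω⟩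
    simp only [Set.mem_iUnion]
    exact ⟨z, Finset.mem_filter.2 ⟨mem_cube.2 fun i => hz ▸ abs_le_l1 z i, hz⟩, hω⟩
  calc
    _ ≤ P.real (⋃ z ∈ (cube d L).filter fun z => l1 z = L,
        {ω | K * L ≤ vertexTime (fun e => τ e ω) 0 z}) :=
      measureReal_mono hsub (measure_ne_top _ _)
    _ ≤ ∑ z ∈ (cube d L).filter fun z => l1 z = L,
        P.real {ω | K * L ≤ vertexTime (fun e => τ e ω) 0 z} := measureReal_biUnion_finset_le _ _
    _ ≤ ∑ z ∈ (cube d L).filter fun z => l1 z = L, (1 / 2 : ℝ) ^ L := by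
      refine Finset.sum_le_sum fun z hz => ?_
      rw [← hK]
      exact h.measureReal_le_time_le e₀ K (Finset.mem_filter.1 hz).2
    _ ≤ (2 * L + 1) ^ d * (1 / 2) ^ L := by
      rw [Finset.sum_const, nsmul_eq_mul]
      refine mul_le_mul_of_nonneg_right ?_ (by positivity)
      have := (Finset.card_filter_le (cube d L) fun z => l1 z = L).trans_eq (card_cube d L)
      exact_mod_cast this

/-! ### The time constant -/

theorem integral_time_add_le (h : ExpWeights P τ l) [Nonempty (Edge d)] (x y : Fin d → ℤ) :
    ∫ ω, vertexTime (fun e => τ e ω) 0 (x + y) ∂P ≤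
      ∫ ω, vertexTime (fun e => τ e ω) 0 x ∂P + ∫ ω, vertexTime (fun e => τ e ω) 0 y ∂P := by
  have hid : IdentDistrib (fun ω (e : Edge d) => τ ((shift x).mapEdgeSet e) ω)
      (fun ω (e : Edge d) => τ e ω) P P :=
    IdentDistrib.pi (fun e => h.ident _ _) (h.indep.precomp (shift x).mapEdgeSet.injective) h.indep
  have hid' : IdentDistrib
      (fun ω => vertexTime (fun e => τ ((shift x).mapEdgeSet e) ω) 0 y)
      (fun ω => vertexTime (fun e => τ e ω) 0 y) P P :=
    hid.comp (measurable_vertexTime (t := fun e (f : Edge d → ℝ) => f e)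
      (fun e => measurable_pi_apply e) 0 y)
  have hint := hid'.symm.integrable_iff.1 (h.integrable_time y)
  rw [← hid'.integral_eq, ← integral_add (h.integrable_time x) hint]
  refine integral_mono (h.integrable_time _) ((h.integrable_time x).add hint) fun ω => ?_
  refine (vertexTime_triangle (fun e => h.nonneg e ω) 0 x (x + y)).trans ?_
  have := vertexTime_add_le (fun e => h.nonneg e ω) 0 y x
  rw [zero_add, add_comm y x] at this
  exact add_le_add le_rfl this

end ExpWeights

/-- The lattice point `n e₁`. -/
def axis (d : ℕ) (n : ℤ) : Fin d → ℤ := fun i => if (i : ℕ) = 0 then n else 0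

theorem axis_add (m n : ℤ) : axis d (m + n) = axis d m + axis d n := by
  funext i
  by_cases hi : (i : ℕ) = 0 <;> simp [axis, hi]

theorem l1_axis (hd : 0 < d) (n : ℤ) : l1 (axis d n) = |n| := by
  rw [l1, Finset.sum_eq_single ⟨0, hd⟩]
  · simp [axis]
  · intro i _ hi
    have : (i : ℕ) ≠ 0 := fun h => hi (Fin.ext h)
    simp [axis, this]
  · simp

theorem floorPt_smul_e₁ (t : ℝ) : floorPt (t • e₁ d) = axis d ⌊t⌋ := by
  funext i
  by_cases hi : (i : ℕ) = 0 <;> simp [floorPt, axis, e₁, hi]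

theorem floorPt_zero : floorPt (0 : Fin d → ℝ) = 0 := by
  funext i
  simp [floorPt]

theorem firstPassageTime_e₁ (t : Edge d → ℝ) (s : ℝ) :
    firstPassageTime t 0 (s • e₁ d) = vertexTime t 0 (axis d ⌊s⌋) := by
  rw [← floorPt_smul_e₁, ← floorPt_zero]
  rfl

theorem nonempty_edge (hd : 0 < d) : Nonempty (Edge d) := by
  obtain ⟨y, hy, -⟩ := exists_adj_l1 (x := axis d 1) (k := 0) (by simp [l1_axis hd])
  exact ⟨⟨s(y, axis d 1), hy⟩⟩

namespace ExpWeights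

variable {Ω : Type*} [MeasurableSpace Ω] {P : Measure Ω} [IsProbabilityMeasure P]
  {τ : Edge d → Ω → ℝ} {l : ℝ}

/-- By subadditivity, the mean passage time to `n e₁` is at least `n` times the time constant. -/
theorem timeConstant_mul_le (h : ExpWeights P τ l) (hd : 0 < d) (n : ℕ) :
    timeConstant P τ (e₁ d) * n ≤ ∫ ω, vertexTime (fun e => τ e ω) 0 (axis d n) ∂P := by
  have := nonempty_edge hd
  set a : ℕ → ℝ := fun n => ∫ ω, vertexTime (fun e => τ e ω) 0 (axis d n) ∂P with ha
  have ha0 (n : ℕ) : 0 ≤ a n :=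
    integral_nonneg fun ω => vertexTime_nonneg (fun e => h.nonneg e ω) _ _
  have hsub : Subadditive a := fun m n => by
    simp only [ha, Nat.cast_add, axis_add]
    exact h.integral_time_add_le _ _
  have hbdd : BddBelow (Set.range fun n => a n / n) :=
    ⟨0, by rintro _ ⟨n, rfl⟩; exact div_nonneg (ha0 n) n.cast_nonneg⟩
  have hlim : Tendsto (fun t : ℝ => t⁻¹ * a ⌊t⌋₊) atTop (𝓝 hsub.lim) := by
    have h1 := ((hsub.tendsto_lim hbdd).comp (tendsto_nat_floor_atTop (α := ℝ))).mul
      (tendsto_nat_floor_div_atTop (R := ℝ))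
    rw [mul_one] at h1
    refine h1.congr' ?_
    filter_upwards [eventually_ge_atTop 1] with t ht
    have : (⌊t⌋₊ : ℝ) ≠ 0 := by
      have := Nat.floor_pos.2 ht
      positivity
    simp only [Function.comp_apply]
    field_simp
  have hμ : timeConstant P τ (e₁ d) = hsub.lim := by
    refine Tendsto.limUnder_eq (hlim.congr' ?_)
    filter_upwards [eventually_ge_atTop 0] with t ht
    simp only [firstPassageTime_e₁, ha, Int.natCast_floor_eq_floor ht]
  rcases Nat.eq_zero_or_pos n with rfl | hn
  · rw [Nat.cast_zero, mul_zero]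
    exact ha0 0
  · rw [hμ, ← le_div_iff₀ (by positivity)]
    exact hsub.lim_le_div hbdd hn.ne'

/-- With a probability bounded away from `0`, the passage time to `n e₁` is at least
`(μ(e₁) - ξ) n`. -/
theorem exists_le_measureReal_time (h : ExpWeights P τ l) (hd : 0 < d) {ξ : ℝ} (hξ : 0 < ξ) :
    ∃ c : ℝ, 0 < c ∧ ∀ n : ℕ, 0 < n →
      c ≤ P.real {ω | (timeConstant P τ (e₁ d) - ξ) * n ≤
        vertexTime (fun e => τ e ω) 0 (axis d n)} := by
  obtain ⟨e₀⟩ := nonempty_edge hd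
  have : Nonempty (Edge d) := ⟨e₀⟩
  have hm : 0 ≤ ∫ ω, τ e₀ ω ^ 2 ∂P := integral_nonneg fun ω => sq_nonneg _
  refine ⟨min 1 (ξ ^ 2 / (∫ ω, τ e₀ ω ^ 2 ∂P + 1)), by positivity, fun n hn => ?_⟩
  obtain ⟨hsq, hle⟩ := h.sq_time_le e₀ (k := n) (x := axis d n) (by simp [l1_axis hd])
  refine le_measureReal_of_sq_le (h.measurable_time _ _)
    (fun ω => vertexTime_nonneg (fun e => h.nonneg e ω) _ _) hsq (h.integrable_time _)
    (n := n) (by positivity) (by positivity) hξ (hle.trans ?_) ?_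
  · gcongr
    linarith
  · refine le_trans (le_of_eq ?_) (h.timeConstant_mul_le hd n)
    ring

/-! ### Lower bound for the upper tail -/

/-- The weights in the ball are independent of the configuration in which they have been replaced
by `M`; when they all exceed `M`, the replacement only decreases the passage times. -/
theorem pow_mul_le_measureReal (h : ExpWeights P τ l) (e₀ : Edge d)
    {M : ℝ} (hM : 0 ≤ M) (b : ℝ) (L : ℕ) (w : Fin d → ℤ) :
    P.real {ω | M < τ e₀ ω} ^ (ballEdges d L).card *
        P.real {ω | b ≤ vertexTime (plant L M fun e => τ e ω) 0 w} ≤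
      P.real {ω | b ≤ vertexTime (fun e => τ e ω) 0 w} := by
  classical
  set A : Set Ω := ⋂ e ∈ ballEdges d L, τ e ⁻¹' Set.Ioi M
  set B : Set Ω := {ω | b ≤ vertexTime (plant L M fun e => τ e ω) 0 w}
  set m : Edge d → MeasurableSpace Ω := fun e => MeasurableSpace.comap (τ e) inferInstance
  have hindep : Indep (⨆ e ∈ (↑(ballEdges d L) : Set (Edge d)), m e)
      (⨆ e ∈ (↑(ballEdges d L) : Set (Edge d))ᶜ, m e) P :=
    indep_iSup_of_disjoint (fun e => (h.meas e).comap_le) h.indep disjoint_compl_right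
  have hAm : MeasurableSet[⨆ e ∈ (↑(ballEdges d L) : Set (Edge d)), m e] A := by
    refine Finset.measurableSet_biInter _ fun e he => ?_
    exact le_iSup₂ (f := fun e (_ : e ∈ (↑(ballEdges d L) : Set (Edge d))) => m e) e he _
      ⟨_, measurableSet_Ioi, rfl⟩
  have hBm : MeasurableSet[⨆ e ∈ (↑(ballEdges d L) : Set (Edge d))ᶜ, m e] B := by
    refine @measurable_vertexTime _ _ (_) (fun e ω => plant L M (fun e => τ e ω) e) (fun e => ?_)
      0 w _ (measurableSet_Ici (a := b))
    by_cases he : e ∈ ballEdges d L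
    · simp only [plant, he, if_true]
      exact measurable_const
    · simp only [plant, he, if_false]
      exact (comap_measurable (τ e)).mono
        (le_iSup₂ (f := fun e (_ : e ∈ (↑(ballEdges d L) : Set (Edge d))ᶜ) => m e) e he) le_rfl
  have hAB : P (A ∩ B) = P A * P B := (Indep_iff _ _ _).1 hindep A B hAm hBm
  have hPA : P A = P {ω | M < τ e₀ ω} ^ (ballEdges d L).card := by
    rw [h.indep.measure_inter_preimage_eq_mul _ fun e _ => measurableSet_Ioi,
      Finset.prod_congr rfl fun e _ => (h.ident e e₀).measure_mem_eq measurableSet_Ioi,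
      Finset.prod_const]
    rfl
  have hsub : A ∩ B ⊆ {ω | b ≤ vertexTime (fun e => τ e ω) 0 w} := by
    rintro ω ⟨hωA, hωB⟩
    refine le_trans (show b ≤ _ from hωB) (vertexTime_mono (fun e => ?_) (fun e => ?_) 0 w)
    · by_cases he : e ∈ ballEdges d L
      · simpa [plant, he] using hM
      · simpa [plant, he] using h.nonneg e ω
    · by_cases he : e ∈ ballEdges d L
      · simp only [plant, he, if_true]
        exact (show M < τ e ω from Set.mem_iInter₂.1 hωA e he).le
      · simp [plant, he]
  refine le_trans (le_of_eq ?_) (measureReal_mono hsub)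
  simp only [measureReal_def, hAB, hPA, ENNReal.toReal_mul, ENNReal.toReal_pow]

/-- With the ball of radius `L ≈ ξ n` slowed down, the passage time to `n e₁` exceeds
`(μ(e₁) + ξ) n` with a probability bounded away from `0`. -/
theorem exists_le_measureReal_plant (h : ExpWeights P τ l) (hd : 0 < d) :
    ∃ M : ℝ, 0 < M ∧ ∀ ξ : ℝ, 0 < ξ → ξ < 1 → ∃ c : ℝ, 0 < c ∧ ∀ᶠ n : ℕ in atTop,
      c ≤ P.real {ω | (timeConstant P τ (e₁ d) + 2 * ξ) * n ≤
        vertexTime (plant ⌈ξ * n⌉₊ M fun e => τ e ω) 0 (axis d n)} := by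
  have := nonempty_edge hd
  obtain ⟨K, hK0, hK⟩ := h.exists_speed
  -- The ball costs `M L`, of which `K L` is lost by starting from its boundary instead of from the
  -- origin, `ξ n` by the fluctuation of the passage time and `2 ξ n` remain.
  refine ⟨K + 3, by positivity, fun ξ hξ hξ1 => ?_⟩
  obtain ⟨c, hc, hcn⟩ := h.exists_le_measureReal_time hd hξ
  refine ⟨c / 2, by positivity, ?_⟩
  have hL : Tendsto (fun n : ℕ => ⌈ξ * n⌉₊) atTop atTop :=
    tendsto_nat_ceil_atTop.comp (tendsto_natCast_atTop_atTop.const_mul_atTop hξ)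
  have hsmall : ∀ᶠ L : ℕ in atTop, ((2 * L + 1) ^ d * (1 / 2) ^ L : ℝ) < c / 2 := by
    have h1 := (tendsto_pow_const_mul_const_pow_of_abs_lt_one d
      (r := (1 / 2 : ℝ)) (by norm_num [abs_of_pos])).const_mul (3 ^ d : ℝ)
    rw [mul_zero] at h1
    filter_upwards [h1.eventually_lt_const (half_pos hc), eventually_ge_atTop 1] with L hL hL1
    refine lt_of_le_of_lt ?_ hL
    have hL1' : (1 : ℝ) ≤ L := by exact_mod_cast hL1
    rw [← mul_assoc, ← mul_pow]
    gcongr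
    linarith
  filter_upwards [hL.eventually hsmall, eventually_gt_atTop 0] with n hn hn0
  set L := ⌈ξ * n⌉₊
  have hnR : (0 : ℝ) < n := by exact_mod_cast hn0
  have hLle : L ≤ n := Nat.ceil_le.2 (by nlinarith)
  have hLge : ξ * n ≤ L := Nat.le_ceil _
  set bad : Set Ω := {ω | ∃ z, l1 z = L ∧ K * L ≤ vertexTime (fun e => τ e ω) 0 z}
  set far : Set Ω := {ω | (timeConstant P τ (e₁ d) - ξ) * n ≤
        vertexTime (fun e => τ e ω) 0 (axis d n)}
  have hsub : far ⊆ bad ∪ {ω | (timeConstant P τ (e₁ d) + 2 * ξ) * n ≤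
        vertexTime (plant L (K + 3) fun e => τ e ω) 0 (axis d n)} := by
    intro ω hω
    by_cases hb : ω ∈ bad
    · exact Or.inl hb
    right
    have hω' : (timeConstant P τ (e₁ d) - ξ) * n ≤
        vertexTime (fun e => τ e ω) 0 (axis d n) := hω
    have hg : ∀ z, l1 z = L → (timeConstant P τ (e₁ d) - ξ) * n - K * L ≤
        vertexTime (fun e => τ e ω) z (axis d n) := fun z hz => by
      have h1 := vertexTime_triangle (fun e => h.nonneg e ω) 0 z (axis d n)
      have h2 : vertexTime (fun e => τ e ω) 0 z < K * L :=
        not_le.1 fun hle => hb ⟨z, hz, hle⟩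
      linarith
    refine le_trans ?_ (le_vertexTime_plant (fun e => h.nonneg e ω) (by positivity)
      (by rw [l1_axis hd, Nat.abs_cast]; exact_mod_cast hLle) hg)
    nlinarith
  have h1 := (hcn n hn0).trans ((measureReal_mono hsub).trans (measureReal_union_le _ _))
  have h2 := (hK L).trans_lt hn
  linarith

theorem exists_upperRate_le (h : ExpWeights P τ l) (hd : 0 < d)
    (hunbdd : ∀ e, ∀ m : ℝ, 0 < m → 0 < P {ω | m < τ e ω}) :
    ∃ C : ℝ, ∀ ξ : ℝ, 0 < ξ → ξ < 1 → upperRate P τ ξ ≤ ((C * ξ ^ d : ℝ) : EReal) := by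
  obtain ⟨e₀⟩ := nonempty_edge hd
  obtain ⟨M, hM, hplant⟩ := h.exists_le_measureReal_plant hd
  set q := P.real {ω | M < τ e₀ ω}
  have hq0 : 0 < q := ENNReal.toReal_pos (hunbdd e₀ M hM).ne' (measure_ne_top _ _)
  have hq1 : q ≤ 1 := measureReal_le_one
  have hlogq : 0 ≤ -Real.log q := neg_nonneg.2 (Real.log_nonpos hq0.le hq1)
  refine ⟨15 ^ d * -Real.log q + 1, fun ξ hξ hξ1 => ?_⟩
  obtain ⟨c, hc, hcn⟩ := hplant ξ hξ hξ1
  have hlim : Tendsto (fun n : ℕ => ((n : ℝ) ^ d)⁻¹ * -Real.log c) atTop (𝓝 0) := by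
    rw [← zero_mul (-Real.log c)]
    exact (tendsto_inv_atTop_zero.comp
      ((tendsto_pow_atTop hd.ne').comp tendsto_natCast_atTop_atTop)).mul_const _
  refine limsup_le_of_le (h := ?_)
  filter_upwards [hcn, hlim.eventually_le_const (show (0 : ℝ) < ξ ^ d by positivity),
    (tendsto_natCast_atTop_atTop.const_mul_atTop hξ).eventually_ge_atTop 1,
    eventually_gt_atTop 0] with n hn hcξ hξn hn0
  have hnR : (0 : ℝ) < n := by exact_mod_cast hn0
  set L := ⌈ξ * n⌉₊
  have hball : ((ballEdges d L).card : ℝ) ≤ (15 * (ξ * n)) ^ d := by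
    have h1 : ((ballEdges d L).card : ℝ) ≤ (2 * L + 1) ^ d * 3 ^ d := by
      exact_mod_cast card_ballEdges_le d L
    refine h1.trans ?_
    rw [← mul_pow]
    have h2 : (L : ℝ) < ξ * n + 1 := Nat.ceil_lt_add_one (by positivity)
    exact pow_le_pow_left₀ (by positivity) (by linarith) d
  have hevent : q ^ (ballEdges d L).card * c ≤ P.real (upperTailEvent P τ ξ n) := by
    refine (mul_le_mul_of_nonneg_left hn (by positivity)).trans
      ((h.pow_mul_le_measureReal e₀ hM.le _ L (axis d n)).trans (measureReal_mono ?_))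
    intro ω hω
    have hω' : (timeConstant P τ (e₁ d) + 2 * ξ) * n ≤
        vertexTime (fun e => τ e ω) 0 (axis d n) := hω
    change (timeConstant P τ (e₁ d) + ξ) * n <
      firstPassageTime (fun e => τ e ω) 0 ((n : ℝ) • e₁ d)
    rw [firstPassageTime_e₁, Int.floor_natCast]
    have : 0 < ξ * n := by positivity
    linarith
  have hpos : 0 < q ^ (ballEdges d L).card * c := by positivity
  have hPpos := hpos.trans_le hevent
  rw [ENNReal.log_pos_real' hPpos, ← EReal.coe_mul, ← EReal.coe_neg, EReal.coe_le_coe_iff]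
  have hlog : -Real.log (P (upperTailEvent P τ ξ n)).toReal ≤
      (ballEdges d L).card * -Real.log q + -Real.log c := by
    have := Real.log_le_log hpos hevent
    rw [Real.log_mul (by positivity) hc.ne', Real.log_pow] at this
    change -Real.log (P.real _) ≤ _
    linarith
  rw [← mul_neg]
  calc ((n : ℝ) ^ d)⁻¹ * -Real.log (P (upperTailEvent P τ ξ n)).toReal
      ≤ ((n : ℝ) ^ d)⁻¹ * ((15 * (ξ * n)) ^ d * -Real.log q + -Real.log c) := by
        gcongr
        exact hlog.trans (by gcongr)
    _ = 15 ^ d * -Real.log q * ξ ^ d + ((n : ℝ) ^ d)⁻¹ * -Real.log c := by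
        rw [mul_pow, mul_pow]
        field_simp
    _ ≤ (15 ^ d * -Real.log q + 1) * ξ ^ d := by linarith

end ExpWeights

end FPP

theorem theorem1p8 {Ω : Type*} [MeasurableSpace Ω] (P : Measure Ω) [IsProbabilityMeasure P]
    (d : ℕ) (hd : 2 ≤ d) (τ : FPP.Edge d → Ω → ℝ)
    (hmeas : ∀ e, Measurable (τ e))
    (hnonneg : ∀ e ω, 0 ≤ τ e ω)
    (hindep : iIndepFun τ P)
    (hident : ∀ e e', IdentDistrib (τ e) (τ e') P P)
    (r α β : ℝ) (hr : (d : ℝ) < r) (hα : 0 < α) (hβ : 0 < β)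
    (htail : ∀ e, ∀ t : ℝ, 0 ≤ t → P.real {ω | t ≤ τ e ω} ≤ β * Real.exp (-α * t ^ r))
    (hunbdd : ∀ e, ∀ m : ℝ, 0 < m → 0 < P {ω | m < τ e ω}) :
    limsup (fun ξ : ℝ => (((ξ ^ d)⁻¹ : ℝ) : EReal) * FPP.upperRate P τ ξ) (𝓝[>] (0 : ℝ)) < ⊤ := by
  have hr1 : 1 ≤ r := by
    have : (2 : ℝ) ≤ d := by exact_mod_cast hd
    linarith
  have hexp (e : FPP.Edge d) : Integrable (fun ω => Real.exp (α / 2 * τ e ω)) P := by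
    refine FPP.integrable_exp_of_tail (hmeas e) (hnonneg e) hα hβ fun k => ?_
    refine (htail e k k.cast_nonneg).trans ?_
    have hk : (k : ℝ) ≤ (k : ℝ) ^ r := by
      rcases Nat.eq_zero_or_pos k with rfl | hk
      · simpa using Real.rpow_nonneg le_rfl r
      · exact Real.self_le_rpow_of_one_le (by exact_mod_cast hk) hr1
    exact mul_le_mul_of_nonneg_left (Real.exp_le_exp.2 (by nlinarith)) hβ.le
  obtain ⟨C, hC⟩ := (FPP.ExpWeights.mk hmeas hnonneg hindep hident (half_pos hα)
    hexp).exists_upperRate_le (by omega) hunbdd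
  refine lt_of_le_of_lt (limsup_le_of_le (a := (C : EReal)) (h := ?_)) (EReal.coe_lt_top C)
  filter_upwards [Ioo_mem_nhdsGT (show (0 : ℝ) < 1 by norm_num)] with ξ hξ
  have hpos : 0 < ξ ^ d := pow_pos hξ.1 d
  refine (mul_le_mul_of_nonneg_left (hC ξ hξ.1 hξ.2) ?_).trans_eq ?_
  · exact_mod_cast (inv_pos.2 hpos).le
  · rw [← EReal.coe_mul]
    congr 1
    field_simp
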